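/- Pure $\lambda$-terms are finite and are taken up to $\alpha$-equivalence; reduction steps may be taken in any context unless stated otherwise. The clocked $\lambda$-calculus extends the $\lambda$-calculus with a unary symbol $\tau$ and has the rules $(\lambda x.M)N \to \tau(M[x:=N])$ and $\tau(M)N \to \tau(MN)$. The clocked Lévy tree of a $\lambda$-term $M$ is its unique infinitary normal form, that is, the unique finite or infinite term without redexes of these two rules to which $M$ reduces by a (possibly infinite) strongly convergent reduction. For finite or infinite terms $S,T$ over $\lambda$, application, $\tau$ and variables, write $S =_\tau T$ if $S$ and $T$ are related by the equivalence closure of the rewrite relation given by the rule $\tau(P) \to P$, that is, if $S$ and $T$ are equal up to inserting and removing finitely many $\tau$'s. A term $N$ eventually matches $M$ if the clocked Lévy trees of $M$ and $N$ are $=_\tau$. A weak head normal form (whnf) is a term $\lambda x.M'$ or $y M_1\ldots M_m$ ($m \ge 0$, $y$ a variable). A head step is $(\lambda x.P)\,Q\,Q_1\ldots Q_k \to P[x:=Q]\,Q_1\ldots Q_k$ ($k\ge 0$). A $\beta$-redex $(\lambda x.P)Q$ is simple if $x$ has at most one occurrence in $P$ (the redex is linear) or $Q$ is a $\beta$-normal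 form (the redex is call-by-value). Simple terms are defined coinductively: a $\lambda$-term $M$ is simple if (a) $M$ has no whnf; or the head reduction of $M$ to whnf contracts only simple redexes and ends in a term of one of the forms (b) $\lambda x.M'$ with $M'$ simple, or (c) $y M_1\ldots M_m$ with $M_1,\ldots,M_m$ simple. Theorem. Let $M$ be a simple $\lambda$-term and let $M \twoheadrightarrow_\beta N$ (finitely many $\beta$-steps). Then $M$ and $N$ have (unique) clocked Lévy trees, and $N$ eventually matches $M$: the clocked Lévy trees of $M$ and $N$ are equal up to inserting and removing finitely many $\tau$'s. -/

import Mathlib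

/-- Finite pure `λ`-terms, up to renaming of bound variables (de Bruijn indices). -/
inductive Lam : Type
  | var : ℕ → Lam
  | lam : Lam → Lam
  | app : Lam → Lam → Lam

/-- Finite terms of the clocked `λ`-calculus: `λ`-terms over a unary symbol `τ`
(de Bruijn indices). -/
inductive CLam : Type
  | var : ℕ → CLam
  | lam : CLam → CLam
  | app : CLam → CLam → CLam
  | tau : CLam → CLam

/-- Lift a renaming under a binder. -/
def liftRen (ρ : ℕ → ℕ) : ℕ → ℕ
  | 0 => 0
  | n + 1 => ρ n + 1

namespace Lam

def rename : (ℕ → ℕ) → Lam → Lam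
  | ρ, var n => var (ρ n)
  | ρ, lam M => lam (rename (liftRen ρ) M)
  | ρ, app M N => app (rename ρ M) (rename ρ N)

/-- Lift a substitution under a binder. -/
def liftSub (σ : ℕ → Lam) : ℕ → Lam
  | 0 => var 0
  | n + 1 => rename Nat.succ (σ n)

/-- Simultaneous capture-avoiding substitution. -/
def subst : (ℕ → Lam) → Lam → Lam
  | σ, var n => σ n
  | σ, lam M => lam (subst (liftSub σ) M)
  | σ, app M N => app (subst σ M) (subst σ N)

/-- The substitution that replaces the variable `0` by `N` and lowers the other variables. -/
def single (N : Lam) : ℕ → Lam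
  | 0 => N
  | n + 1 => var n

/-- `M[x := N]`, where `x` is the variable with index `0` in `M`. -/
def inst (M N : Lam) : Lam := subst (single N) M

/-- The number of free occurrences of the variable with index `k`. -/
def occ : ℕ → Lam → ℕ
  | k, var n => if n = k then 1 else 0
  | k, lam M => occ (k + 1) M
  | k, app M N => occ k M + occ k N

/-- One-step `β`-reduction, in any context. -/
inductive Beta : Lam → Lam → Prop
  | beta (M N : Lam) : Beta (app (lam M) N) (inst M N)
  | lam {M M' : Lam} : Beta M M' → Beta (lam M) (lam M')
  | appL {M M' : Lam} (N : Lam) : Beta M M' → Beta (app M N) (app M' N)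
  | appR (M : Lam) {N N' : Lam} : Beta N N' → Beta (app M N) (app M N')

/-- Finite (many-step) `β`-reduction; `N` is a reduct of `M` when `BetaRed M N`. -/
def BetaRed : Lam → Lam → Prop := Relation.ReflTransGen Beta

/-- `β`-normal form. -/
def IsNormal (M : Lam) : Prop := ∀ N, ¬ Beta M N

/-- `apps M [M₁, …, Mₘ]` is `M M₁ … Mₘ`. -/
def apps (M : Lam) (Ms : List Lam) : Lam := Ms.foldl app M

/-- Weak head normal forms: `λx.M'` and `y M₁ … Mₘ` with `m ≥ 0`. -/
def IsWHNF (M : Lam) : Prop :=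
  (∃ M', M = lam M') ∨ ∃ y Ms, M = apps (var y) Ms

/-- `M` has a weak head normal form. -/
def HasWHNF (M : Lam) : Prop := ∃ W, BetaRed M W ∧ IsWHNF W

/-- The redex `(λx.M)N` is linear: `x` has at most one occurrence in `M`. -/
def IsLinearRedex (M _N : Lam) : Prop := occ 0 M ≤ 1

/-- The redex `(λx.M)N` is call-by-value: `N` is a normal form. -/
def IsCallByValueRedex (_M N : Lam) : Prop := IsNormal N

/-- The redex `(λx.M)N` is simple. -/
def IsSimpleRedex (M N : Lam) : Prop := IsLinearRedex M N ∨ IsCallByValueRedex M N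

/-- A (weak) head step `(λx.M) N N₁ … Nₖ → M[x := N] N₁ … Nₖ` that contracts a simple redex. -/
inductive SimpleHead : Lam → Lam → Prop
  | beta (M N : Lam) : IsSimpleRedex M N → SimpleHead (app (lam M) N) (inst M N)
  | appL {M M' : Lam} (N : Lam) : SimpleHead M M' → SimpleHead (app M N) (app M' N)

/-- The head reduction of `M` leads to `W`, and contracts only simple redexes. -/
def SimpleHeadRed : Lam → Lam → Prop := Relation.ReflTransGen SimpleHead

/-- The three clauses of the definition of simple terms, with the recursive occurrences of
"simple" read as membership in `S`. -/
def SimpleClauses (S : Lam → Prop) (M : Lam) : Prop :=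
  (¬ HasWHNF M) ∨
  (∃ M', SimpleHeadRed M (lam M') ∧ S M') ∨
  (∃ y Ms, SimpleHeadRed M (apps (var y) Ms) ∧ ∀ P ∈ Ms, S P)

/-- Simple terms: the clauses read coinductively, that is, the largest set of terms each of
whose elements satisfies one of the three clauses. -/
def IsSimple (M : Lam) : Prop :=
  ∃ S : Lam → Prop, (∀ P, S P → SimpleClauses S P) ∧ S M

/-- A pure `λ`-term as a term of the clocked `λ`-calculus. -/
def toCLam : Lam → CLam
  | var n => CLam.var n
  | lam M => CLam.lam (toCLam M)
  | app M N => CLam.app (toCLam M) (toCLam N)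

end Lam

namespace CLam

def rename : (ℕ → ℕ) → CLam → CLam
  | ρ, var n => var (ρ n)
  | ρ, lam M => lam (rename (liftRen ρ) M)
  | ρ, app M N => app (rename ρ M) (rename ρ N)
  | ρ, tau M => tau (rename ρ M)

/-- Lift a substitution under a binder. -/
def liftSub (σ : ℕ → CLam) : ℕ → CLam
  | 0 => var 0
  | n + 1 => rename Nat.succ (σ n)

/-- Simultaneous capture-avoiding substitution. -/
def subst : (ℕ → CLam) → CLam → CLam
  | σ, var n => σ n
  | σ, lam M => lam (subst (liftSub σ) M)
  | σ, app M N => app (subst σ M) (subst σ N)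
  | σ, tau M => tau (subst σ M)

/-- The substitution that replaces the variable `0` by `N` and lowers the other variables. -/
def single (N : CLam) : ℕ → CLam
  | 0 => N
  | n + 1 => var n

/-- `M[x := N]`, where `x` is the variable with index `0` in `M`. -/
def inst (M N : CLam) : CLam := subst (single N) M

/-- One step of the clocked `λ`-calculus: the rules `(λx.M)N → τ(M[x := N])` and
`τ(M)N → τ(M N)`, in any context. -/
inductive Step : CLam → CLam → Prop
  | beta (M N : CLam) : Step (app (lam M) N) (tau (inst M N))
  | shift (M N : CLam) : Step (app (tau M) N) (tau (app M N))
  | lam {M M' : CLam} : Step M M' → Step (lam M) (lam M')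
  | appL {M M' : CLam} (N : CLam) : Step M M' → Step (app M N) (app M' N)
  | appR (M : CLam) {N N' : CLam} : Step N N' → Step (app M N) (app M N')
  | tau {M M' : CLam} : Step M M' → Step (tau M) (tau M')

/-- Finite (many-step) reduction of the clocked `λ`-calculus. -/
def Red : CLam → CLam → Prop := Relation.ReflTransGen Step

end CLam

/-- The node labels of possibly infinite clocked terms. -/
inductive NodeLabel : Type
  | var : ℕ → NodeLabel
  | lam : NodeLabel
  | app : NodeLabel
  | tau : NodeLabel

/-- The index type of the children of a node: none for a variable, one for `λ` and `τ`, two for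
an application (`false` is the function, `true` the argument). -/
def NodeLabel.Child : NodeLabel → Type
  | var _ => Empty
  | lam => Unit
  | app => Bool
  | tau => Unit

/-- The signature functor of the clocked `λ`-calculus. -/
abbrev clockedSig : PFunctor.{0, 0} := ⟨NodeLabel, NodeLabel.Child⟩

/-- Finite and infinite terms of the clocked `λ`-calculus (de Bruijn indices): the final coalgebra
of the signature, that is, all finite and infinite trees over `λ`, application, `τ` and
variables. -/
abbrev CInf : Type := clockedSig.M

namespace CInf

def var (n : ℕ) : CInf :=
  PFunctor.M.mk (F := clockedSig) ⟨NodeLabel.var n, fun e : Empty => e.elim⟩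

def lam (T : CInf) : CInf :=
  PFunctor.M.mk (F := clockedSig) ⟨NodeLabel.lam, fun _ : Unit => T⟩

def app (S T : CInf) : CInf :=
  PFunctor.M.mk (F := clockedSig) ⟨NodeLabel.app, fun b : Bool => cond b T S⟩

def tau (T : CInf) : CInf :=
  PFunctor.M.mk (F := clockedSig) ⟨NodeLabel.tau, fun _ : Unit => T⟩

/-- Some subterm of `T` is a redex `(λx.P)Q` or `τ(P)Q` of the clocked `λ`-calculus. -/
inductive HasRedex : CInf → Prop
  | beta (P Q : CInf) : HasRedex (app (lam P) Q)
  | shift (P Q : CInf) : HasRedex (app (tau P) Q)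
  | lam {P : CInf} : HasRedex P → HasRedex (lam P)
  | appL {P : CInf} (Q : CInf) : HasRedex P → HasRedex (app P Q)
  | appR (P : CInf) {Q : CInf} : HasRedex Q → HasRedex (app P Q)
  | tau {P : CInf} : HasRedex P → HasRedex (tau P)

/-- Normal forms of the clocked `λ`-calculus among the finite and infinite terms. -/
def IsNormal (T : CInf) : Prop := ¬ HasRedex T

/-- The rule `τ(M) → M`, applied once, at any position of a finite or infinite term. -/
inductive TauStep : CInf → CInf → Prop
  | tauElim (P : CInf) : TauStep (tau P) P
  | lam {P P' : CInf} : TauStep P P' → TauStep (lam P) (lam P')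
  | appL {P P' : CInf} (Q : CInf) : TauStep P P' → TauStep (app P Q) (app P' Q)
  | appR (P : CInf) {Q Q' : CInf} : TauStep Q Q' → TauStep (app P Q) (app P Q')
  | tau {P P' : CInf} : TauStep P P' → TauStep (tau P) (tau P')

/-- `=_τ`, the equivalence closure of the rule `τ(M) → M`: equality up to inserting and removing
finitely many `τ`'s. -/
def TauEq : CInf → CInf → Prop := Relation.EqvGen TauStep

end CInf

namespace CLam

/-- One layer of infinitary reduction: finitely many steps lead to a term with the root symbol of
the target, and its immediate subterms are related by `R` to those of the target. -/
inductive InfRedLayer (R : CLam → CInf → Prop) : CLam → CInf → Prop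
  | var {M : CLam} {n : ℕ} : Red M (var n) → InfRedLayer R M (CInf.var n)
  | lam {M P : CLam} {P' : CInf} :
      Red M (lam P) → R P P' → InfRedLayer R M (CInf.lam P')
  | app {M P Q : CLam} {P' Q' : CInf} :
      Red M (app P Q) → R P P' → R Q Q' → InfRedLayer R M (CInf.app P' Q')
  | tau {M P : CLam} {P' : CInf} :
      Red M (tau P) → R P P' → InfRedLayer R M (CInf.tau P')

/-- Infinitary (strongly convergent) reduction of the clocked `λ`-calculus from a finite term to a
finite or infinite term, in its coinductive form: the largest relation that is contained in its
own layer. All terms reached from a finite term by finitely many steps, and their subterms, are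
finite; so only the target can be infinite. -/
def InfRed (M : CLam) (T : CInf) : Prop :=
  ∃ R : CLam → CInf → Prop, (∀ P P', R P P' → InfRedLayer R P P') ∧ R M T

end CLam

namespace Lam

/-- `T` is a clocked Lévy tree of `M`: an infinitary normal form of `M` in the clocked
`λ`-calculus. -/
def IsClockedLevyTree (M : Lam) (T : CInf) : Prop :=
  CLam.InfRed M.toCLam T ∧ T.IsNormal

/-- `M` eventually matches `N`: their clocked Lévy trees are `=_τ`. -/
def EventuallyMatches (M N : Lam) : Prop :=
  ∃ S T : CInf, IsClockedLevyTree M S ∧ IsClockedLevyTree N T ∧ CInf.TauEq S T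

end Lam

/-! Every pure term has a clocked Lévy tree computed by weak head reduction (`levyTree`): a head
step leaves one τ, and a term without head step shows its root symbol. The tree is normal by
construction. Uniqueness rests on confluence of finite reduction (`red_confluent`) and on the fact
that a function part whose limit is normal and is neither an abstraction nor a τ can never become
one (`InfRed.not_isActive`).

To compare the trees of `M` and `N`, the length of the β-reduction from `M` to `N` serves as a
budget while both trees are descended in parallel. Contracting a simple redex does not multiply the
steps of its argument: a linear redex makes at most one copy, and a call-by-value argument has no
steps. Hence (`SimpleHead.project`) either the head redex is contracted in the reduction, and then
the tree of `M` has an extra τ while the budget strictly decreases, or it survives in `N`, and then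
both trees show a τ and the budget does not grow. Under a head variable the budget is divided among
the arguments, and terms without whnf all have the tree consisting of τ's only. So only finitely
many τ's are removed, and `tauEq_of_match` turns this into `=_τ`. -/

namespace CLam

/-! ### Renaming and substitution in clocked terms -/

theorem liftRen_comp (ρ ρ' : ℕ → ℕ) : liftRen ρ' ∘ liftRen ρ = liftRen (ρ' ∘ ρ) := by
  funext n; cases n <;> rfl

theorem rename_rename (M : CLam) : ∀ ρ ρ' : ℕ → ℕ,
    rename ρ' (rename ρ M) = rename (ρ' ∘ ρ) M := by
  induction M with
  | var n => intros; rfl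
  | lam M ih => intros; simp only [rename, ih, liftRen_comp]
  | app M N ihM ihN => intros; simp only [rename, ihM, ihN]
  | tau M ih => intros; simp only [rename, ih]

theorem liftSub_comp_liftRen (σ : ℕ → CLam) (ρ : ℕ → ℕ) :
    liftSub σ ∘ liftRen ρ = liftSub (σ ∘ ρ) := by
  funext n; cases n <;> rfl

theorem subst_rename (M : CLam) : ∀ (ρ : ℕ → ℕ) (σ : ℕ → CLam),
    subst σ (rename ρ M) = subst (σ ∘ ρ) M := by
  induction M with
  | var n => intros; rfl
  | lam M ih => intros; simp only [rename, subst, ih, liftSub_comp_liftRen]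
  | app M N ihM ihN => intros; simp only [rename, subst, ihM, ihN]
  | tau M ih => intros; simp only [rename, subst, ih]

theorem rename_comp_liftSub (ρ : ℕ → ℕ) (σ : ℕ → CLam) :
    rename (liftRen ρ) ∘ liftSub σ = liftSub (rename ρ ∘ σ) := by
  funext n
  cases n with
  | zero => rfl
  | succ n => simp only [Function.comp_apply, liftSub, rename_rename]; rfl

theorem rename_subst (M : CLam) : ∀ (σ : ℕ → CLam) (ρ : ℕ → ℕ),
    rename ρ (subst σ M) = subst (rename ρ ∘ σ) M := by
  induction M with
  | var n => intros; rfl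
  | lam M ih => intros; simp only [rename, subst, ih, rename_comp_liftSub]
  | app M N ihM ihN => intros; simp only [rename, subst, ihM, ihN]
  | tau M ih => intros; simp only [rename, subst, ih]

theorem subst_comp_liftSub (σ σ' : ℕ → CLam) :
    subst (liftSub σ') ∘ liftSub σ = liftSub (subst σ' ∘ σ) := by
  funext n
  cases n with
  | zero => rfl
  | succ n => simp only [Function.comp_apply, liftSub, subst_rename, rename_subst]; rfl

theorem subst_subst (M : CLam) : ∀ σ σ' : ℕ → CLam,
    subst σ' (subst σ M) = subst (subst σ' ∘ σ) M := by
  induction M with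
  | var n => intros; rfl
  | lam M ih => intros; simp only [subst, ih, subst_comp_liftSub]
  | app M N ihM ihN => intros; simp only [subst, ihM, ihN]
  | tau M ih => intros; simp only [subst, ih]

theorem liftSub_var_comp (ρ : ℕ → ℕ) : liftSub (var ∘ ρ) = var ∘ liftRen ρ := by
  funext n; cases n <;> rfl

theorem rename_eq_subst (M : CLam) : ∀ ρ : ℕ → ℕ, rename ρ M = subst (var ∘ ρ) M := by
  induction M with
  | var n => intros; rfl
  | lam M ih => intros; simp only [rename, subst, ih, liftSub_var_comp]
  | app M N ihM ihN => intros; simp only [rename, subst, ihM, ihN]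
  | tau M ih => intros; simp only [rename, subst, ih]

theorem liftSub_var : liftSub var = var := by
  funext n; cases n <;> rfl

theorem subst_var (M : CLam) : subst var M = M := by
  induction M with
  | var n => rfl
  | lam M ih => simp only [subst, liftSub_var, ih]
  | app M N ihM ihN => simp only [subst, ihM, ihN]
  | tau M ih => simp only [subst, ih]

theorem subst_inst (σ : ℕ → CLam) (M N : CLam) :
    subst σ (inst M N) = inst (subst (liftSub σ) M) (subst σ N) := by
  simp only [inst, subst_subst]
  congr 1
  funext n
  cases n with
  | zero => rfl
  | succ n =>
    simp only [Function.comp_apply, liftSub, subst_rename]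
    exact (subst_var _).symm

theorem rename_inst (ρ : ℕ → ℕ) (M N : CLam) :
    rename ρ (inst M N) = inst (rename (liftRen ρ) M) (rename ρ N) := by
  simp only [rename_eq_subst, subst_inst, liftSub_var_comp]

/-! ### Confluence of finite clocked reduction -/

/-- Parallel reduction of the clocked `λ`-calculus. -/
inductive Par : CLam → CLam → Prop
  | var (n : ℕ) : Par (var n) (var n)
  | lam {M M' : CLam} : Par M M' → Par (lam M) (lam M')
  | app {M M' N N' : CLam} : Par M M' → Par N N' → Par (app M N) (app M' N')
  | tau {M M' : CLam} : Par M M' → Par (tau M) (tau M')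
  | beta {M M' N N' : CLam} : Par M M' → Par N N' → Par (app (lam M) N) (tau (inst M' N'))
  | shift {M M' N N' : CLam} : Par M M' → Par N N' → Par (app (tau M) N) (tau (app M' N'))

theorem Par.refl (M : CLam) : Par M M := by
  induction M with
  | var n => exact .var n
  | lam M ih => exact .lam ih
  | app M N ihM ihN => exact .app ihM ihN
  | tau M ih => exact .tau ih

theorem Step.par {M N : CLam} (h : Step M N) : Par M N := by
  induction h with
  | beta M N => exact .beta (.refl M) (.refl N)
  | shift M N => exact .shift (.refl M) (.refl N)
  | lam _ ih => exact .lam ih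
  | appL N _ ih => exact .app ih (.refl N)
  | appR M _ ih => exact .app (.refl M) ih
  | tau _ ih => exact .tau ih

theorem Red.lam {M N : CLam} (h : Red M N) : Red (lam M) (lam N) :=
  Relation.ReflTransGen.lift CLam.lam (fun _ _ => Step.lam) _ _ h

theorem Red.tau {M N : CLam} (h : Red M N) : Red (tau M) (tau N) :=
  Relation.ReflTransGen.lift CLam.tau (fun _ _ => Step.tau) _ _ h

theorem Red.appL {M M' : CLam} (N : CLam) (h : Red M M') : Red (app M N) (app M' N) :=
  Relation.ReflTransGen.lift (fun X => CLam.app X N) (fun _ _ => Step.appL N) _ _ h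

theorem Red.appR (M : CLam) {N N' : CLam} (h : Red N N') : Red (app M N) (app M N') :=
  Relation.ReflTransGen.lift (CLam.app M) (fun _ _ => Step.appR M) _ _ h

theorem Red.app {M M' N N' : CLam} (hM : Red M M') (hN : Red N N') :
    Red (app M N) (app M' N') :=
  (hM.appL N).trans (hN.appR M')

theorem Par.red {M N : CLam} (h : Par M N) : Red M N := by
  induction h with
  | var n => exact .refl
  | lam _ ih => exact ih.lam
  | app _ _ ihM ihN => exact ihM.app ihN
  | tau _ ih => exact ih.tau
  | beta _ _ ihM ihN => exact (ihM.lam.app ihN).tail (.beta _ _)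
  | shift _ _ ihM ihN => exact (ihM.tau.app ihN).tail (.shift _ _)

theorem Par.rename {M M' : CLam} (h : Par M M') :
    ∀ ρ : ℕ → ℕ, Par (CLam.rename ρ M) (CLam.rename ρ M') := by
  induction h with
  | var n => exact fun ρ => .var _
  | lam _ ih => exact fun ρ => .lam (ih _)
  | app _ _ ihM ihN => exact fun ρ => .app (ihM ρ) (ihN ρ)
  | tau _ ih => exact fun ρ => .tau (ih ρ)
  | beta _ _ ihM ihN =>
    intro ρ
    simp only [CLam.rename, rename_inst]
    exact .beta (ihM _) (ihN ρ)
  | shift _ _ ihM ihN => exact fun ρ => .shift (ihM ρ) (ihN ρ)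

theorem par_liftSub {σ σ' : ℕ → CLam} (h : ∀ n, Par (σ n) (σ' n)) (n : ℕ) :
    Par (liftSub σ n) (liftSub σ' n) := by
  cases n with
  | zero => exact .var 0
  | succ n => exact (h n).rename _

theorem Par.subst {M M' : CLam} (h : Par M M') :
    ∀ {σ σ' : ℕ → CLam}, (∀ n, Par (σ n) (σ' n)) → Par (CLam.subst σ M) (CLam.subst σ' M') := by
  induction h with
  | var n => exact fun hσ => hσ n
  | lam _ ih => exact fun hσ => .lam (ih (par_liftSub hσ))
  | app _ _ ihM ihN => exact fun hσ => .app (ihM hσ) (ihN hσ)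
  | tau _ ih => exact fun hσ => .tau (ih hσ)
  | beta _ _ ihM ihN =>
    intro σ σ' hσ
    simp only [CLam.subst, subst_inst]
    exact .beta (ihM (par_liftSub hσ)) (ihN hσ)
  | shift _ _ ihM ihN => exact fun hσ => .shift (ihM hσ) (ihN hσ)

theorem Par.inst {M M' N N' : CLam} (hM : Par M M') (hN : Par N N') :
    Par (CLam.inst M N) (CLam.inst M' N') := by
  refine hM.subst fun n => ?_
  cases n with
  | zero => exact hN
  | succ n => exact .var n

/-- The complete development of all redexes of a term. -/
def develop : CLam → CLam
  | var n => var n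
  | lam M => lam (develop M)
  | tau M => tau (develop M)
  | app (lam M) N => tau (inst (develop M) (develop N))
  | app (tau M) N => tau (app (develop M) (develop N))
  | app (var n) N => app (var n) (develop N)
  | app (app M M') N => app (develop (app M M')) (develop N)

theorem Par.develop {M N : CLam} (h : Par M N) : Par N M.develop := by
  induction h with
  | var n => exact .var n
  | lam _ ih => exact .lam ih
  | tau _ ih => exact .tau ih
  | beta _ _ ihM ihN => exact .tau (ihM.inst ihN)
  | shift _ _ ihM ihN => exact .tau (.app ihM ihN)
  | @app M M' N N' hM _ ihM ihN =>
    cases M with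
    | var n => exact .app ihM ihN
    | app _ _ => exact .app ihM ihN
    -- The step left the root redex alone, while `develop` contracts it; the reduced function part
    -- keeps its root symbol, so the redex is still there.
    | lam P =>
      cases hM with
      | lam _ => cases ihM with | lam h => exact .beta h ihN
    | tau P =>
      cases hM with
      | tau _ => cases ihM with | tau h => exact .shift h ihN

/-- `Step` lies inside `Par` and `Par` inside `Red`, so both generate the same many-step reduction;
the complete development joins any two parallel steps from a term. -/
theorem red_confluent {M N N' : CLam} (h : Red M N) (h' : Red M N') :
    ∃ P, Red N P ∧ Red N' P := by
  have par_of_red : ∀ {A B : CLam}, Red A B → Relation.ReflTransGen Par A B :=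
    fun h => Relation.ReflTransGen.mono (fun _ _ => Step.par) _ _ h
  have red_of_par : ∀ {A B : CLam}, Relation.ReflTransGen Par A B → Red A B := by
    intro A B h
    induction h with
    | refl => exact .refl
    | tail _ h ih => exact ih.trans h.red
  obtain ⟨P, hP, hP'⟩ := Relation.church_rosser
    (fun a b c hb hc => ⟨a.develop, .single hb.develop, .single hc.develop⟩)
    (par_of_red h) (par_of_red h')
  exact ⟨P, red_of_par hP, red_of_par hP'⟩

theorem Red.of_var {n : ℕ} {X : CLam} (h : Red (var n) X) : X = var n := by
  induction h with
  | refl => rfl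
  | tail _ h ih => subst ih; cases h

theorem Red.of_lam {P X : CLam} (h : Red (CLam.lam P) X) : ∃ P', X = CLam.lam P' ∧ Red P P' := by
  induction h with
  | refl => exact ⟨P, rfl, .refl⟩
  | tail _ h ih =>
    obtain ⟨P', rfl, hP⟩ := ih
    cases h with
    | lam h => exact ⟨_, rfl, hP.tail h⟩

theorem Red.of_tau {P X : CLam} (h : Red (CLam.tau P) X) : ∃ P', X = CLam.tau P' ∧ Red P P' := by
  induction h with
  | refl => exact ⟨P, rfl, .refl⟩
  | tail _ h ih =>
    obtain ⟨P', rfl, hP⟩ := ih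
    cases h with
    | tau h => exact ⟨_, rfl, hP.tail h⟩

/-- A term that reduces to an abstraction or to a term `τ(L)`. -/
def IsActive (P : CLam) : Prop := ∃ L, Red P (lam L) ∨ Red P (tau L)

/-- Both root rules produce a τ, so an application never becomes an abstraction or a variable, and
it becomes a τ only if its function part was active. -/
theorem Red.of_app {P Q X : CLam} (h : Red (CLam.app P Q) X) :
    (∃ P' Q', X = CLam.app P' Q' ∧ Red P P' ∧ Red Q Q') ∨
      ((∃ Y, X = CLam.tau Y) ∧ IsActive P) := by
  induction h with
  | refl => exact .inl ⟨P, Q, rfl, .refl, .refl⟩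
  | tail _ h ih =>
    rcases ih with ⟨P', Q', rfl, hP, hQ⟩ | ⟨⟨Y, rfl⟩, hP⟩
    · cases h with
      | beta L _ => exact .inr ⟨⟨_, rfl⟩, L, .inl hP⟩
      | shift L _ => exact .inr ⟨⟨_, rfl⟩, L, .inr hP⟩
      | appL _ h => exact .inl ⟨_, _, rfl, hP.tail h, hQ⟩
      | appR _ h => exact .inl ⟨_, _, rfl, hP, hQ.tail h⟩
    · cases h with
      | tau h => exact .inr ⟨⟨_, rfl⟩, hP⟩

end CLam

/-! ### Infinite terms: constructors, bisimulation, `=_τ` -/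

namespace CInf

theorem dest_var (n : ℕ) : (var n).dest = ⟨NodeLabel.var n, fun e : Empty => e.elim⟩ :=
  PFunctor.M.dest_mk _

theorem dest_lam (T : CInf) : (lam T).dest = ⟨NodeLabel.lam, fun _ : Unit => T⟩ :=
  PFunctor.M.dest_mk _

theorem dest_app (S T : CInf) : (app S T).dest = ⟨NodeLabel.app, fun b : Bool => cond b T S⟩ :=
  PFunctor.M.dest_mk _

theorem dest_tau (T : CInf) : (tau T).dest = ⟨NodeLabel.tau, fun _ : Unit => T⟩ :=
  PFunctor.M.dest_mk _

theorem eq_of_dest_eq {S T : CInf} (h : S.dest = T.dest) : S = T := by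
  rw [← PFunctor.M.mk_dest S, h, PFunctor.M.mk_dest]

/-- The label of the root. -/
def label (T : CInf) : NodeLabel := T.dest.1

theorem label_var (n : ℕ) : label (var n) = .var n := by rw [label, dest_var]
theorem label_lam (T : CInf) : label (lam T) = .lam := by rw [label, dest_lam]
theorem label_app (S T : CInf) : label (app S T) = .app := by rw [label, dest_app]
theorem label_tau (T : CInf) : label (tau T) = .tau := by rw [label, dest_tau]

theorem lam_inj {S T : CInf} (h : lam S = lam T) : S = T := by
  have h := PFunctor.M.mk_inj h
  exact congrFun (eq_of_heq (Sigma.mk.inj h).2) ()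

theorem tau_inj {S T : CInf} (h : tau S = tau T) : S = T := by
  have h := PFunctor.M.mk_inj h
  exact congrFun (eq_of_heq (Sigma.mk.inj h).2) ()

theorem app_inj {S S' T T' : CInf} (h : app S T = app S' T') : S = S' ∧ T = T' := by
  have h := eq_of_heq (Sigma.mk.inj (PFunctor.M.mk_inj h)).2
  exact ⟨congrFun h false, congrFun h true⟩

/-- One layer of a bisimulation of clocked terms. -/
inductive BisimLayer (R : CInf → CInf → Prop) : CInf → CInf → Prop
  | refl (T : CInf) : BisimLayer R T T
  | lam {S T : CInf} : R S T → BisimLayer R (lam S) (lam T)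
  | app {S S' T T' : CInf} : R S S' → R T T' → BisimLayer R (app S T) (app S' T')
  | tau {S T : CInf} : R S T → BisimLayer R (tau S) (tau T)

/-- Coinduction up to equality: adding the diagonal to `R` gives a bisimulation. -/
theorem eq_of_bisim (R : CInf → CInf → Prop) (hR : ∀ S T, R S T → BisimLayer R S T) {S T : CInf}
    (h : R S T) : S = T := by
  refine PFunctor.M.bisim (fun S T => S = T ∨ R S T) ?_ S T (.inr h)
  intro S T hST
  have key : BisimLayer R S T := by
    rcases hST with rfl | hST
    · exact .refl _
    · exact hR _ _ hST
  cases key with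
  | refl T => exact ⟨_, _, _, Sigma.eta _ |>.symm, Sigma.eta _ |>.symm, fun _ => .inl rfl⟩
  | lam h => exact ⟨_, _, _, dest_lam _, dest_lam _, fun _ => .inr h⟩
  | tau h => exact ⟨_, _, _, dest_tau _, dest_tau _, fun _ => .inr h⟩
  | app h h' =>
    refine ⟨_, _, _, dest_app _ _, dest_app _ _, fun b => ?_⟩
    cases (b : Bool)
    · exact .inr h
    · exact .inr h'

theorem TauEq.refl (T : CInf) : TauEq T T := Relation.EqvGen.refl T

theorem TauEq.lift (f : CInf → CInf) (hf : ∀ {S T}, TauStep S T → TauStep (f S) (f T))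
    {S T : CInf} (h : TauEq S T) : TauEq (f S) (f T) := by
  induction h with
  | rel _ _ h => exact .rel _ _ (hf h)
  | refl _ => exact .refl _
  | symm _ _ _ ih => exact .symm _ _ ih
  | trans _ _ _ _ _ ih ih' => exact .trans _ _ _ ih ih'

theorem TauEq.app {S S' T T' : CInf} (h : TauEq S S') (h' : TauEq T T') :
    TauEq (app S T) (app S' T') :=
  .trans _ _ _ (h.lift (fun X => CInf.app X T) (TauStep.appL T))
    (h'.lift (CInf.app S') (TauStep.appR S'))

/-! ### Comparison with a budget of removals -/

/-- One layer of a comparison of two clocked terms in which a budget of `n` symbols `τ` may be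
removed from the left-hand side. -/
inductive MatchLayer (K : ℕ → CInf → CInf → Prop) : ℕ → CInf → CInf → Prop
  | refl (n : ℕ) (T : CInf) : MatchLayer K n T T
  | drop {m n : ℕ} {S T : CInf} : m < n → K m S T → MatchLayer K n (tau S) T
  | lam {n : ℕ} {S T : CInf} : K n S T → MatchLayer K n (lam S) (lam T)
  | tau {n : ℕ} {S T : CInf} : K n S T → MatchLayer K n (tau S) (tau T)
  | app {a b n : ℕ} {S S' T T' : CInf} : a + b ≤ n → K a S S' → K b T T' →
      MatchLayer K n (app S T) (app S' T')

/-- Budget 0 forces equality. For budget `n`, suppose the terms are not `=_τ`. By induction no τ is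
dropped, and at an application one side keeps the whole budget and is again not `=_τ`, while the
other has budget 0 and is equal. Following this forever is a bisimulation, so the terms are equal, a
contradiction. -/
theorem tauEq_of_match (K : ℕ → CInf → CInf → Prop)
    (hK : ∀ n S T, K n S T → MatchLayer K n S T) (n : ℕ) :
    ∀ S T, K n S T → TauEq S T := by
  have eq_of_zero : ∀ {S T}, K 0 S T → S = T := by
    intro S T h
    refine eq_of_bisim (K 0) (fun S T hK0 => ?_) h
    cases hK _ _ _ hK0 with
    | refl => exact .refl _
    | drop h _ => exact absurd h (Nat.not_lt_zero _)
    | lam h => exact .lam h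
    | tau h => exact .tau h
    | @app a b _ _ _ _ _ hab h h' =>
      obtain ⟨rfl, rfl⟩ : a = 0 ∧ b = 0 := by omega
      exact .app h h'
  induction n using Nat.strong_induction_on with
  | _ n ih =>
    intro S T h
    by_contra hne
    have hST : S = T := by
      refine eq_of_bisim (fun S T => S = T ∨ (K n S T ∧ ¬ TauEq S T)) ?_ (.inr ⟨h, hne⟩)
      rintro S T (rfl | ⟨hKn, hne⟩)
      · exact .refl _
      cases hK _ _ _ hKn with
      | refl => exact .refl _
      | drop hm h => exact absurd (.trans _ _ _ (.rel _ _ (.tauElim _)) (ih _ hm _ _ h)) hne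
      | lam h => exact .lam (.inr ⟨h, fun h => hne (h.lift CInf.lam TauStep.lam)⟩)
      | tau h => exact .tau (.inr ⟨h, fun h => hne (h.lift CInf.tau TauStep.tau)⟩)
      | @app a b _ S S' T T' hab h₁ h₂ =>
        by_cases ha : a < n
        · by_cases hb : b < n
          · exact absurd ((ih a ha _ _ h₁).app (ih b hb _ _ h₂)) hne
          · obtain ⟨rfl, rfl⟩ : a = 0 ∧ b = n := by omega
            obtain rfl := eq_of_zero h₁
            exact .app (.inl rfl) (.inr ⟨h₂, fun h' => hne ((TauEq.refl S).app h')⟩)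
        · obtain ⟨rfl, rfl⟩ : a = n ∧ b = 0 := by omega
          obtain rfl := eq_of_zero h₂
          exact .app (.inr ⟨h₁, fun h => hne (h.app (TauEq.refl T))⟩) (.inl rfl)
    exact hne (hST ▸ TauEq.refl S)

end CInf

/-! ### Infinitary reduction and uniqueness of normal forms -/

namespace CLam

theorem InfRedLayer.mono {R R' : CLam → CInf → Prop} (hR : ∀ P T, R P T → R' P T) {M : CLam}
    {T : CInf} (h : InfRedLayer R M T) : InfRedLayer R' M T := by
  cases h with
  | var h => exact .var h
  | lam h h' => exact .lam h (hR _ _ h')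
  | tau h h' => exact .tau h (hR _ _ h')
  | app h h₁ h₂ => exact .app h (hR _ _ h₁) (hR _ _ h₂)

theorem InfRed.layer {M : CLam} {T : CInf} (h : InfRed M T) : InfRedLayer InfRed M T := by
  obtain ⟨R, hR, h⟩ := h
  exact (hR _ _ h).mono fun P T h => ⟨R, hR, h⟩

theorem InfRed.of_layer {M : CLam} {T : CInf} (h : InfRedLayer InfRed M T) : InfRed M T :=
  ⟨InfRedLayer InfRed, fun _ _ h => h.mono fun _ _ => InfRed.layer, h⟩

theorem InfRedLayer.of_red {R : CLam → CInf → Prop} {M M' : CLam} {T : CInf} (h : Red M M')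
    (h' : InfRedLayer R M' T) : InfRedLayer R M T := by
  cases h' with
  | var h₀ => exact .var (h.trans h₀)
  | lam h₀ h₁ => exact .lam (h.trans h₀) h₁
  | tau h₀ h₁ => exact .tau (h.trans h₀) h₁
  | app h₀ h₁ h₂ => exact .app (h.trans h₀) h₁ h₂

theorem InfRed.of_red {M M' : CLam} {T : CInf} (h : Red M M') (h' : InfRed M' T) : InfRed M T :=
  .of_layer (h'.layer.of_red h)

end CLam

namespace CInf

theorem IsNormal.of_lam {P : CInf} (h : (lam P).IsNormal) : P.IsNormal := fun h' => h (.lam h')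

theorem IsNormal.of_tau {P : CInf} (h : (tau P).IsNormal) : P.IsNormal := fun h' => h (.tau h')

/-- Neither an abstraction nor a term `τ(P)`. -/
def IsRigid (T : CInf) : Prop := (∀ P, T ≠ lam P) ∧ ∀ P, T ≠ tau P

theorem IsNormal.of_app {P Q : CInf} (h : (app P Q).IsNormal) :
    P.IsNormal ∧ Q.IsNormal ∧ P.IsRigid :=
  ⟨fun h' => h (.appL Q h'), fun h' => h (.appR P h'),
    fun _ e => h (e ▸ .beta _ _), fun _ e => h (e ▸ .shift _ _)⟩

end CInf

namespace CLam

/-- Induction on the finite term: if an application has an application as its normal limit, the left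
child of that limit is again normal and rigid, so the function part is not active and the root is
never contracted. -/
theorem InfRed.not_isActive {P : CLam} : ∀ {T : CInf}, InfRed P T → T.IsNormal → T.IsRigid →
    ¬ IsActive P := by
  induction P with
  | var n =>
    rintro T - - - ⟨L, h | h⟩ <;> cases h.of_var
  | lam P _ =>
    intro T hPT _ hT
    cases hPT.layer with
    | var h => obtain ⟨_, e, _⟩ := h.of_lam; cases e
    | lam _ _ => exact absurd rfl (hT.1 _)
    | tau _ _ => exact absurd rfl (hT.2 _)
    | app h _ _ => obtain ⟨_, e, _⟩ := h.of_lam; cases e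
  | tau P _ =>
    intro T hPT _ hT
    cases hPT.layer with
    | var h => obtain ⟨_, e, _⟩ := h.of_tau; cases e
    | lam _ _ => exact absurd rfl (hT.1 _)
    | tau _ _ => exact absurd rfl (hT.2 _)
    | app h _ _ => obtain ⟨_, e, _⟩ := h.of_tau; cases e
  | app P Q ih _ =>
    intro T hPT hn hT
    cases hPT.layer with
    | var h => rcases h.of_app with ⟨_, _, e, _⟩ | ⟨⟨_, e⟩, _⟩ <;> cases e
    | lam _ _ => exact absurd rfl (hT.1 _)
    | tau _ _ => exact absurd rfl (hT.2 _)
    | app h h₁ _ =>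
      rcases h.of_app with ⟨_, _, e, hP, _⟩ | ⟨⟨_, e⟩, _⟩
      · cases e
        have hP := ih (.of_red hP h₁) hn.of_app.1 hn.of_app.2.2
        rintro ⟨L, h | h⟩
        · rcases h.of_app with ⟨_, _, e, _⟩ | ⟨⟨_, e⟩, _⟩ <;> cases e
        · rcases h.of_app with ⟨_, _, e, _⟩ | ⟨_, h⟩
          · cases e
          · exact hP h
      · cases e

/-- Confluence joins the given reduct with each finite stage of the infinitary reduction. Normality
of `T` excludes that an application in `T` gets lost because the common reduct has a τ at its root.
-/
theorem InfRed.red {M M' : CLam} {T : CInf} (h : InfRed M T) (hT : T.IsNormal) (hM : Red M M') :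
    InfRed M' T := by
  refine ⟨fun M' T => ∃ M, Red M M' ∧ InfRed M T ∧ T.IsNormal, ?_, M, hM, h, hT⟩
  rintro M' T ⟨M, hM, hMT, hT⟩
  cases hMT.layer with
  | var h =>
    obtain ⟨X, hX, hX'⟩ := red_confluent hM h
    obtain rfl := hX'.of_var
    exact .var hX
  | lam h h' =>
    obtain ⟨X, hX, hX'⟩ := red_confluent hM h
    obtain ⟨P, rfl, hP⟩ := hX'.of_lam
    exact .lam hX ⟨_, hP, h', hT.of_lam⟩
  | tau h h' =>
    obtain ⟨X, hX, hX'⟩ := red_confluent hM h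
    obtain ⟨P, rfl, hP⟩ := hX'.of_tau
    exact .tau hX ⟨_, hP, h', hT.of_tau⟩
  | app h h₁ h₂ =>
    obtain ⟨X, hX, hX'⟩ := red_confluent hM h
    obtain ⟨hP, hQ, hr⟩ := hT.of_app
    rcases hX'.of_app with ⟨P, Q, rfl, hP', hQ'⟩ | ⟨_, ha⟩
    · exact .app hX ⟨_, hP', h₁, hP⟩ ⟨_, hQ', h₂, hQ⟩
    · exact absurd ha (h₁.not_isActive hP hr)

theorem infRed_normal_unique {M : CLam} {S T : CInf} (hS : InfRed M S) (nS : S.IsNormal)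
    (hT : InfRed M T) (nT : T.IsNormal) : S = T := by
  refine CInf.eq_of_bisim
    (fun S T => ∃ M, InfRed M S ∧ S.IsNormal ∧ InfRed M T ∧ T.IsNormal) ?_ ⟨M, hS, nS, hT, nT⟩
  rintro S T ⟨M, hS, nS, hT, nT⟩
  cases hS.layer with
  | var h =>
    cases (hT.red nT h).layer with
    | var h => cases h.of_var; exact .refl _
    | lam h _ => cases h.of_var
    | tau h _ => cases h.of_var
    | app h _ _ => cases h.of_var
  | lam h hP =>
    cases (hT.red nT h).layer with
    | var h => obtain ⟨_, e, _⟩ := h.of_lam; cases e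
    | lam h hP' =>
      obtain ⟨_, e, h⟩ := h.of_lam
      cases e
      exact .lam ⟨_, hP, nS.of_lam, .of_red h hP', nT.of_lam⟩
    | tau h _ => obtain ⟨_, e, _⟩ := h.of_lam; cases e
    | app h _ _ => obtain ⟨_, e, _⟩ := h.of_lam; cases e
  | tau h hP =>
    cases (hT.red nT h).layer with
    | var h => obtain ⟨_, e, _⟩ := h.of_tau; cases e
    | tau h hP' =>
      obtain ⟨_, e, h⟩ := h.of_tau
      cases e
      exact .tau ⟨_, hP, nS.of_tau, .of_red h hP', nT.of_tau⟩
    | lam h _ => obtain ⟨_, e, _⟩ := h.of_tau; cases e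
    | app h _ _ => obtain ⟨_, e, _⟩ := h.of_tau; cases e
  | app h hP hQ =>
    obtain ⟨nP, nQ, rP⟩ := nS.of_app
    cases (hT.red nT h).layer with
    | var h => rcases h.of_app with ⟨_, _, e, _⟩ | ⟨⟨_, e⟩, _⟩ <;> cases e
    | lam h _ => rcases h.of_app with ⟨_, _, e, _⟩ | ⟨⟨_, e⟩, _⟩ <;> cases e
    | tau h _ =>
      rcases h.of_app with ⟨_, _, e, _⟩ | ⟨_, ha⟩
      · cases e
      · exact absurd ha (hP.not_isActive nP rP)
    | app h hP' hQ' =>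
      rcases h.of_app with ⟨_, _, e, h₁, h₂⟩ | ⟨⟨_, e⟩, _⟩
      · cases e
        obtain ⟨nP', nQ', _⟩ := nT.of_app
        exact .app ⟨_, hP, nP, .of_red h₁ hP', nP'⟩ ⟨_, hQ, nQ, .of_red h₂ hQ', nQ'⟩
      · cases e

end CLam

/-! ### Pure terms inside clocked terms -/

namespace Lam

/-- Allows substitution identities to be pulled back from clocked terms. -/
theorem toCLam_injective : Function.Injective toCLam := by
  intro M
  induction M with
  | var n => intro N h; cases N <;> simp_all [toCLam]
  | lam M ih =>
    intro N h
    cases N <;> simp only [toCLam, reduceCtorEq, CLam.lam.injEq] at h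
    rw [ih h]
  | app M M' ih ih' =>
    intro N h
    cases N <;> simp only [toCLam, reduceCtorEq, CLam.app.injEq] at h
    rw [ih h.1, ih' h.2]

theorem toCLam_rename (M : Lam) : ∀ ρ, (rename ρ M).toCLam = M.toCLam.rename ρ := by
  induction M with
  | var n => intros; rfl
  | lam M ih => intros; simp only [rename, toCLam, CLam.rename, ih]
  | app M N ihM ihN => intros; simp only [rename, toCLam, CLam.rename, ihM, ihN]

theorem toCLam_comp_liftSub (σ : ℕ → Lam) :
    toCLam ∘ liftSub σ = CLam.liftSub (toCLam ∘ σ) := by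
  funext n
  cases n with
  | zero => rfl
  | succ n => exact toCLam_rename _ _

theorem toCLam_subst (M : Lam) : ∀ σ, (subst σ M).toCLam = M.toCLam.subst (toCLam ∘ σ) := by
  induction M with
  | var n => intros; rfl
  | lam M ih => intros; simp only [subst, toCLam, CLam.subst, ih, toCLam_comp_liftSub]
  | app M N ihM ihN => intros; simp only [subst, toCLam, CLam.subst, ihM, ihN]

theorem toCLam_inst (M N : Lam) : (inst M N).toCLam = M.toCLam.inst N.toCLam := by
  rw [inst, toCLam_subst, CLam.inst]
  congr 1
  funext n
  cases n <;> rfl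

theorem subst_inst (σ : ℕ → Lam) (M N : Lam) :
    subst σ (inst M N) = inst (subst (liftSub σ) M) (subst σ N) := by
  apply toCLam_injective
  simp only [toCLam_subst, toCLam_inst, CLam.subst_inst, toCLam_comp_liftSub]

theorem rename_inst (ρ : ℕ → ℕ) (M N : Lam) :
    rename ρ (inst M N) = inst (rename (liftRen ρ) M) (rename ρ N) := by
  apply toCLam_injective
  simp only [toCLam_rename, toCLam_inst, CLam.rename_inst]

theorem Beta.rename {M N : Lam} (h : Beta M N) :
    ∀ ρ : ℕ → ℕ, Beta (Lam.rename ρ M) (Lam.rename ρ N) := by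
  induction h with
  | beta M N => intro ρ; rw [rename_inst]; exact .beta _ _
  | lam _ ih => exact fun ρ => .lam (ih _)
  | appL N _ ih => exact fun ρ => .appL _ (ih ρ)
  | appR M _ ih => exact fun ρ => .appR _ (ih ρ)

theorem Beta.subst {M N : Lam} (h : Beta M N) :
    ∀ σ : ℕ → Lam, Beta (Lam.subst σ M) (Lam.subst σ N) := by
  induction h with
  | beta M N => intro σ; rw [subst_inst]; exact .beta _ _
  | lam _ ih => exact fun σ => .lam (ih _)
  | appL N _ ih => exact fun σ => .appL _ (ih σ)
  | appR M _ ih => exact fun σ => .appR _ (ih σ)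

/-! ### Counting β-steps -/

/-- `β`-reduction in exactly `n` steps. -/
inductive BetaN : ℕ → Lam → Lam → Prop
  | refl (M : Lam) : BetaN 0 M M
  | head {n : ℕ} {M N P : Lam} : Beta M N → BetaN n N P → BetaN (n + 1) M P

theorem BetaN.trans {m n : ℕ} {M N P : Lam} (h : BetaN m M N) (h' : BetaN n N P) :
    BetaN (m + n) M P := by
  induction h with
  | refl M => rwa [Nat.zero_add]
  | head hb _ ih => rw [Nat.add_right_comm]; exact .head hb (ih h')

theorem BetaN.map (f : Lam → Lam) (hf : ∀ {M N}, Beta M N → Beta (f M) (f N)) {n : ℕ} {M N : Lam}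
    (h : BetaN n M N) : BetaN n (f M) (f N) := by
  induction h with
  | refl M => exact .refl _
  | head hb _ ih => exact .head (hf hb) ih

theorem BetaN.app {a b : ℕ} {M M' N N' : Lam} (h : BetaN a M M') (h' : BetaN b N N') :
    BetaN (a + b) (app M N) (app M' N') :=
  (h.map (fun X => Lam.app X N) (Beta.appL N)).trans (h'.map (Lam.app M') (Beta.appR M'))

theorem exists_betaN {M N : Lam} (h : BetaRed M N) : ∃ n, BetaN n M N := by
  induction h using Relation.ReflTransGen.head_induction_on with
  | refl => exact ⟨0, .refl _⟩
  | head h _ ih => obtain ⟨n, ih⟩ := ih; exact ⟨n + 1, .head h ih⟩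

theorem BetaN.red {n : ℕ} {M N : Lam} (h : BetaN n M N) : BetaRed M N := by
  induction h with
  | refl M => exact .refl
  | head h _ ih => exact .head h ih

theorem BetaN.of_isNormal {n : ℕ} {M N : Lam} (h : BetaN n M N) (hM : M.IsNormal) :
    n = 0 ∧ N = M := by
  cases h with
  | refl => exact ⟨rfl, rfl⟩
  | head h _ => exact absurd h (hM _)

theorem BetaN.of_lam {n : ℕ} {M N : Lam} (h : BetaN n (lam M) N) :
    ∃ N', N = lam N' ∧ BetaN n M N' := by
  generalize hX : lam M = X at h
  induction h generalizing M with
  | refl => exact ⟨M, hX.symm, .refl _⟩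
  | head hb _ ih =>
    subst hX
    cases hb with
    | lam hb =>
      obtain ⟨N', rfl, h⟩ := ih rfl
      exact ⟨N', rfl, .head hb h⟩

/-- Split at the first contraction of the root, if there is one: until then the two components
reduce independently. The `+ 1` counts that contraction. -/
theorem BetaN.of_app {n : ℕ} {P Q N : Lam} (h : BetaN n (Lam.app P Q) N) :
    (∃ a b P' Q', N = Lam.app P' Q' ∧ BetaN a P P' ∧ BetaN b Q Q' ∧ a + b = n) ∨
    (∃ a b r L Q', BetaN a P (lam L) ∧ BetaN b Q Q' ∧ BetaN r (inst L Q') N ∧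
      a + b + r + 1 = n) := by
  generalize hX : Lam.app P Q = X at h
  induction h generalizing P Q with
  | refl => exact .inl ⟨0, 0, P, Q, hX.symm, .refl _, .refl _, rfl⟩
  | @head n _ _ _ hb hr ih =>
    subst hX
    cases hb with
    | beta L _ => exact .inr ⟨0, 0, n, L, Q, .refl _, .refl _, hr, by omega⟩
    | appL _ hb =>
      rcases ih rfl with ⟨a, b, P', Q', e, hP, hQ, hn⟩ | ⟨a, b, r, L, Q', hP, hQ, hr, hn⟩
      · exact .inl ⟨a + 1, b, P', Q', e, .head hb hP, hQ, by omega⟩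
      · exact .inr ⟨a + 1, b, r, L, Q', .head hb hP, hQ, hr, by omega⟩
    | appR _ hb =>
      rcases ih rfl with ⟨a, b, P', Q', e, hP, hQ, hn⟩ | ⟨a, b, r, L, Q', hP, hQ, hr, hn⟩
      · exact .inl ⟨a, b + 1, P', Q', e, hP, .head hb hQ, by omega⟩
      · exact .inr ⟨a, b + 1, r, L, Q', hP, .head hb hQ, hr, by omega⟩

/-! ### Simple redexes do not multiply steps -/

theorem liftSub_congr {σ σ' : ℕ → Lam} {k : ℕ} (h : ∀ n, n ≠ k → σ n = σ' n) (n : ℕ)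
    (hn : n ≠ k + 1) : liftSub σ n = liftSub σ' n := by
  cases n with
  | zero => rfl
  | succ n => simp only [liftSub, h n (by omega)]

theorem subst_congr_of_occ_eq_zero (A : Lam) : ∀ {k : ℕ} {σ σ' : ℕ → Lam}, occ k A = 0 →
    (∀ n, n ≠ k → σ n = σ' n) → subst σ A = subst σ' A := by
  induction A with
  | var n =>
    intro k σ σ' h hσ
    refine hσ n fun e => ?_
    simp [occ, e] at h
  | lam A ih => intro k σ σ' h hσ; simp only [subst, ih h (liftSub_congr hσ)]
  | app A B ihA ihB =>
    intro k σ σ' h hσ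
    simp only [occ, Nat.add_eq_zero_iff] at h
    simp only [subst, ihA h.1 hσ, ihB h.2 hσ]

/-- With at most one occurrence of `k`, the steps from `σ k` to `σ' k` are replayed in at most one
place. -/
theorem BetaN.subst_of_occ_le_one (A : Lam) : ∀ {k b : ℕ} {σ σ' : ℕ → Lam}, occ k A ≤ 1 →
    (∀ n, n ≠ k → σ n = σ' n) → BetaN b (σ k) (σ' k) →
    ∃ m ≤ b, BetaN m (subst σ A) (subst σ' A) := by
  induction A with
  | var n =>
    intro k b σ σ' _ hσ hb
    by_cases h : n = k
    · subst h; exact ⟨b, le_rfl, hb⟩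
    · refine ⟨0, Nat.zero_le _, ?_⟩
      simp only [subst, hσ n h]
      exact .refl _
  | lam A ih =>
    intro k b σ σ' h hσ hb
    obtain ⟨m, hm, h⟩ := ih (k := k + 1) h (liftSub_congr hσ)
      (hb.map (rename Nat.succ) fun h => h.rename _)
    exact ⟨m, hm, h.map lam Beta.lam⟩
  | app A B ihA ihB =>
    intro k b σ σ' h hσ hb
    simp only [occ] at h
    by_cases hA : occ k A = 0
    · obtain ⟨m, hm, h⟩ := ihB (by omega) hσ hb
      refine ⟨m, hm, ?_⟩
      simp only [subst, subst_congr_of_occ_eq_zero A hA hσ]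
      exact h.map (Lam.app _) (Beta.appR _)
    · obtain ⟨m, hm, h⟩ := ihA (by omega) hσ hb
      refine ⟨m, hm, ?_⟩
      simp only [subst, subst_congr_of_occ_eq_zero B (by omega) hσ]
      exact h.map (fun X => Lam.app X _) (Beta.appL _)

/-- Contracting a simple redex does not multiply the steps inside it. -/
theorem BetaN.inst_of_isSimpleRedex {a b : ℕ} {A A' B B' : Lam} (h : IsSimpleRedex A B)
    (hA : BetaN a A A') (hB : BetaN b B B') : ∃ m ≤ a + b, BetaN m (inst A B) (inst A' B') := by
  -- The steps of the body come after those of the argument, because the occurrence bound is known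
  -- for `A` only.
  have hA' := hA.map (fun X => inst X B') fun h => h.subst _
  rcases h with h | h
  · obtain ⟨m, hm, h⟩ := BetaN.subst_of_occ_le_one A (k := 0) (σ := single B) (σ' := single B') h
      (fun n hn => by cases n with | zero => exact absurd rfl hn | succ n => rfl) hB
    exact ⟨m + a, by omega, h.trans hA'⟩
  · obtain ⟨-, rfl⟩ := hB.of_isNormal h
    exact ⟨a, by omega, hA'⟩

/-! ### Head steps and neutral terms -/

/-- The result of the (weak) head step, if there is one. -/
def headStep : Lam → Option Lam
  | var _ => none
  | lam _ => none
  | app (var _) _ => none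
  | app (lam P) Q => some (inst P Q)
  | app (app P P') Q => (headStep (app P P')).map fun X => app X Q

theorem headStep_app {P P' : Lam} (Q : Lam) (h : headStep P = some P') :
    headStep (app P Q) = some (app P' Q) := by
  cases P with
  | var n => cases h
  | lam P => cases h
  | app P₁ P₂ => simp only [headStep, h, Option.map_some]

theorem headStep_app_cases {P Q X : Lam} (h : headStep (app P Q) = some X) :
    (∃ L, P = lam L ∧ X = inst L Q) ∨ ∃ P', headStep P = some P' ∧ X = app P' Q := by
  cases P with
  | var n => cases h
  | lam P => cases h; exact .inl ⟨P, rfl, rfl⟩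
  | app P₁ P₂ =>
    simp only [headStep, Option.map_eq_some_iff] at h
    obtain ⟨P', h, rfl⟩ := h
    exact .inr ⟨P', h, rfl⟩

theorem headStep_beta {M : Lam} : ∀ {M' : Lam}, headStep M = some M' → Beta M M' := by
  induction M with
  | var n => intro _ h; cases h
  | lam M _ => intro _ h; cases h
  | app P Q ih _ =>
    intro M' h
    rcases headStep_app_cases h with ⟨L, rfl, rfl⟩ | ⟨P', hP, rfl⟩
    · exact .beta _ _
    · exact .appL _ (ih hP)

/-- The τ created at the head redex is carried outward past the remaining arguments by the shift
rule. -/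
theorem headStep_red {M : Lam} : ∀ {M' : Lam}, headStep M = some M' →
    CLam.Red M.toCLam (CLam.tau M'.toCLam) := by
  induction M with
  | var n => intro _ h; cases h
  | lam M _ => intro _ h; cases h
  | app P Q ih _ =>
    intro M' h
    rcases headStep_app_cases h with ⟨L, rfl, rfl⟩ | ⟨P', hP, rfl⟩
    · rw [toCLam_inst]
      exact .single (.beta _ _)
    · exact ((ih hP).appL Q.toCLam).tail (.shift _ _)

theorem SimpleHead.headStep {M M' : Lam} (h : SimpleHead M M') : headStep M = some M' := by
  induction h with
  | beta M N _ => rfl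
  | appL N _ ih => exact headStep_app N ih

/-- Terms `y M₁ … Mₘ` with all `Mᵢ` satisfying `S`. -/
inductive Neutral (S : Lam → Prop) : Lam → Prop
  | var (n : ℕ) : Neutral S (var n)
  | app {P Q : Lam} : Neutral S P → S Q → Neutral S (app P Q)

theorem neutral_apps {S : Lam → Prop} (Ms : List Lam) : ∀ {M : Lam}, Neutral S M →
    (∀ P ∈ Ms, S P) → Neutral S (apps M Ms) := by
  induction Ms with
  | nil => exact fun h _ => h
  | cons P Ms ih =>
    exact fun h hS => ih (.app h (hS P (by simp))) fun Q hQ => hS Q (by simp [hQ])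

theorem Neutral.eq_apps {S : Lam → Prop} {M : Lam} (h : Neutral S M) :
    ∃ y Ms, M = apps (Lam.var y) Ms := by
  induction h with
  | var n => exact ⟨n, [], rfl⟩
  | @app P Q _ _ ih =>
    obtain ⟨y, Ms, rfl⟩ := ih
    exact ⟨y, Ms ++ [Q], by simp [apps]⟩

theorem Neutral.headStep {S : Lam → Prop} {M : Lam} (h : Neutral S M) :
    Lam.headStep M = none := by
  induction h with
  | var n => rfl
  | @app P Q h _ ih =>
    cases h with
    | var n => rfl
    | app _ _ => simp only [Lam.headStep, ih, Option.map_none]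

theorem Neutral.betaN {S : Lam → Prop} {M : Lam} (h : Neutral S M) :
    ∀ {n : ℕ} {N : Lam}, BetaN n M N → Neutral (fun _ => True) N := by
  induction h with
  | var n =>
    intro _ N h
    cases h with
    | refl => exact .var n
    | head h _ => cases h
  | app _ _ ih =>
    intro _ N h
    rcases h.of_app with ⟨a, b, P', Q', rfl, hP, -, -⟩ | ⟨a, b, r, L, Q', hP, -⟩
    · exact .app (ih hP) trivial
    · cases ih hP

theorem headStep_eq_none {M : Lam} (h : headStep M = none) :
    (∃ L, M = lam L) ∨ Neutral (fun _ => True) M := by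
  induction M with
  | var n => exact .inr (.var n)
  | lam M _ => exact .inl ⟨M, rfl⟩
  | app P Q ih _ =>
    cases P with
    | var n => exact .inr (.app (.var n) trivial)
    | lam P => cases h
    | app P₁ P₂ =>
      simp only [headStep, Option.map_eq_none_iff] at h
      rcases ih h with ⟨L, e⟩ | h
      · cases e
      · exact .inr (.app h trivial)

/-! ### The clocked Lévy tree by head reduction -/

/-- One layer of the clocked Lévy tree. -/
def treeStep : Lam → clockedSig Lam
  | var n => ⟨NodeLabel.var n, fun e : Empty => e.elim⟩
  | lam M => ⟨NodeLabel.lam, fun _ : Unit => M⟩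
  | app M N =>
    match headStep (app M N) with
    | some M' => ⟨NodeLabel.tau, fun _ : Unit => M'⟩
    | none => ⟨NodeLabel.app, fun b : Bool => cond b N M⟩

/-- The clocked Lévy tree, computed by head reduction. -/
def levyTree (M : Lam) : CInf := PFunctor.M.corec treeStep M

theorem levyTree_var (n : ℕ) : levyTree (var n) = CInf.var n := by
  apply CInf.eq_of_dest_eq
  rw [levyTree, PFunctor.M.dest_corec, CInf.dest_var]
  simp only [treeStep]
  refine Sigma.ext rfl (heq_of_eq ?_)
  funext e
  exact e.elim

theorem levyTree_lam (M : Lam) : levyTree (lam M) = CInf.lam (levyTree M) := by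
  apply CInf.eq_of_dest_eq
  rw [levyTree, PFunctor.M.dest_corec, CInf.dest_lam]
  rfl

theorem levyTree_of_headStep {M M' : Lam} (h : headStep M = some M') :
    levyTree M = CInf.tau (levyTree M') := by
  cases M with
  | var n => cases h
  | lam M => cases h
  | app P Q =>
    apply CInf.eq_of_dest_eq
    rw [levyTree, PFunctor.M.dest_corec, CInf.dest_tau]
    simp only [treeStep, h]
    rfl

theorem levyTree_app {P Q : Lam} (h : headStep (app P Q) = none) :
    levyTree (app P Q) = CInf.app (levyTree P) (levyTree Q) := by
  apply CInf.eq_of_dest_eq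
  rw [levyTree, PFunctor.M.dest_corec, CInf.dest_app]
  simp only [treeStep, h]
  refine Sigma.ext rfl (heq_of_eq ?_)
  funext b
  cases (b : Bool) <;> rfl

theorem infRed_levyTree (M : Lam) : CLam.InfRed M.toCLam M.levyTree := by
  refine ⟨fun P T => ∃ M : Lam, P = M.toCLam ∧ T = M.levyTree, ?_, M, rfl, rfl⟩
  rintro _ _ ⟨M, rfl, rfl⟩
  cases h : headStep M with
  | some M' =>
    rw [levyTree_of_headStep h]
    exact .tau (headStep_red h) ⟨M', rfl, rfl⟩
  | none =>
    cases M with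
    | var n => rw [levyTree_var]; exact .var .refl
    | lam M => rw [levyTree_lam]; exact .lam .refl ⟨M, rfl, rfl⟩
    | app P Q => rw [levyTree_app h]; exact .app .refl ⟨P, rfl, rfl⟩ ⟨Q, rfl, rfl⟩

theorem levyTree_eq_lam {M : Lam} {T : CInf} (h : M.levyTree = CInf.lam T) :
    ∃ M', M = lam M' ∧ T = M'.levyTree := by
  have hl := congrArg CInf.label h
  rw [CInf.label_lam] at hl
  cases hs : headStep M with
  | some M' => rw [levyTree_of_headStep hs, CInf.label_tau] at hl; cases hl
  | none =>
    cases M with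
    | var n => rw [levyTree_var, CInf.label_var] at hl; cases hl
    | lam M => rw [levyTree_lam] at h; exact ⟨M, rfl, (CInf.lam_inj h).symm⟩
    | app P Q => rw [levyTree_app hs, CInf.label_app] at hl; cases hl

theorem levyTree_eq_tau {M : Lam} {T : CInf} (h : M.levyTree = CInf.tau T) :
    ∃ M', headStep M = some M' ∧ T = M'.levyTree := by
  have hl := congrArg CInf.label h
  rw [CInf.label_tau] at hl
  cases hs : headStep M with
  | some M' =>
    rw [levyTree_of_headStep hs] at h
    exact ⟨M', rfl, (CInf.tau_inj h).symm⟩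
  | none =>
    cases M with
    | var n => rw [levyTree_var, CInf.label_var] at hl; cases hl
    | lam M => rw [levyTree_lam, CInf.label_lam] at hl; cases hl
    | app P Q => rw [levyTree_app hs, CInf.label_app] at hl; cases hl

theorem levyTree_eq_app {M : Lam} {S T : CInf} (h : M.levyTree = CInf.app S T) :
    ∃ P Q, M = app P Q ∧ headStep M = none ∧ S = P.levyTree ∧ T = Q.levyTree := by
  have hl := congrArg CInf.label h
  rw [CInf.label_app] at hl
  cases hs : headStep M with
  | some M' => rw [levyTree_of_headStep hs, CInf.label_tau] at hl; cases hl
  | none =>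
    cases M with
    | var n => rw [levyTree_var, CInf.label_var] at hl; cases hl
    | lam M => rw [levyTree_lam, CInf.label_lam] at hl; cases hl
    | app P Q =>
      rw [levyTree_app hs] at h
      obtain ⟨h₁, h₂⟩ := CInf.app_inj h
      exact ⟨P, Q, rfl, rfl, h₁.symm, h₂.symm⟩

/-- An application node arises only from a term without head step, whereas a λ or τ as its left
child would supply one. -/
theorem isNormal_levyTree (M : Lam) : M.levyTree.IsNormal := by
  intro h
  generalize hT : M.levyTree = T at h
  induction h generalizing M with
  | beta P Q =>
    obtain ⟨P', Q', rfl, hn, h, -⟩ := levyTree_eq_app hT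
    obtain ⟨L, rfl, -⟩ := levyTree_eq_lam h.symm
    cases hn
  | shift P Q =>
    obtain ⟨P', Q', rfl, hn, h, -⟩ := levyTree_eq_app hT
    obtain ⟨L, hL, -⟩ := levyTree_eq_tau h.symm
    rw [headStep_app Q' hL] at hn
    cases hn
  | lam _ ih => obtain ⟨M', -, h⟩ := levyTree_eq_lam hT; exact ih M' h.symm
  | tau _ ih => obtain ⟨M', -, h⟩ := levyTree_eq_tau hT; exact ih M' h.symm
  | appL _ _ ih => obtain ⟨P, Q, -, -, h, -⟩ := levyTree_eq_app hT; exact ih P h.symm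
  | appR _ _ ih => obtain ⟨P, Q, -, -, -, h⟩ := levyTree_eq_app hT; exact ih Q h.symm

theorem isClockedLevyTree_levyTree (M : Lam) : M.IsClockedLevyTree M.levyTree :=
  ⟨infRed_levyTree M, isNormal_levyTree M⟩

theorem existsUnique_isClockedLevyTree (M : Lam) : ∃! T : CInf, M.IsClockedLevyTree T :=
  ⟨M.levyTree, isClockedLevyTree_levyTree M, fun _ h =>
    CLam.infRed_normal_unique h.1 h.2 (infRed_levyTree M) (isNormal_levyTree M)⟩

/-! ### Simple terms and their reducts -/

theorem exists_headStep_of_not_hasWHNF {M : Lam} (h : ¬ HasWHNF M) :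
    ∃ M', headStep M = some M' ∧ ¬ HasWHNF M' := by
  cases hs : headStep M with
  | some M' =>
    exact ⟨M', rfl, fun ⟨W, hW, hW'⟩ => h ⟨W, .head (headStep_beta hs) hW, hW'⟩⟩
  | none =>
    refine absurd ⟨M, .refl, ?_⟩ h
    rcases headStep_eq_none hs with h | h
    · exact .inl h
    · exact .inr h.eq_apps

theorem levyTree_eq_of_not_hasWHNF {M N : Lam} (hM : ¬ HasWHNF M) (hN : ¬ HasWHNF N) :
    M.levyTree = N.levyTree := by
  refine CInf.eq_of_bisim (fun S T => ∃ M N : Lam, S = M.levyTree ∧ T = N.levyTree ∧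
    ¬ HasWHNF M ∧ ¬ HasWHNF N) ?_ ⟨M, N, rfl, rfl, hM, hN⟩
  rintro _ _ ⟨M, N, rfl, rfl, hM, hN⟩
  obtain ⟨M', h, hM'⟩ := exists_headStep_of_not_hasWHNF hM
  obtain ⟨N', h', hN'⟩ := exists_headStep_of_not_hasWHNF hN
  rw [levyTree_of_headStep h, levyTree_of_headStep h']
  exact .tau ⟨M', N', rfl, rfl, hM', hN'⟩

theorem IsSimple.clauses {M : Lam} (h : M.IsSimple) : SimpleClauses IsSimple M := by
  obtain ⟨S, hS, h⟩ := h
  have hS' : ∀ P, S P → IsSimple P := fun P h => ⟨S, hS, h⟩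
  rcases hS M h with h | ⟨M', h, h'⟩ | ⟨y, Ms, h, h'⟩
  · exact .inl h
  · exact .inr (.inl ⟨M', h, hS' _ h'⟩)
  · exact .inr (.inr ⟨y, Ms, h, fun P hP => hS' _ (h' P hP)⟩)

theorem IsSimple.of_clauses {M : Lam} (h : SimpleClauses IsSimple M) : M.IsSimple := by
  refine ⟨SimpleClauses IsSimple, fun P h => ?_, h⟩
  rcases h with h | ⟨M', h, h'⟩ | ⟨y, Ms, h, h'⟩
  · exact .inl h
  · exact .inr (.inl ⟨M', h, h'.clauses⟩)
  · exact .inr (.inr ⟨y, Ms, h, fun P hP => (h' P hP).clauses⟩)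

/-- The definition runs through a whole head reduction at once, the tree through one head step at a
time; so the first step is split off, and what remains is again simple. -/
theorem IsSimple.cases_head {M : Lam} (h : M.IsSimple) :
    (¬ HasWHNF M) ∨ (∃ M', M = lam M' ∧ M'.IsSimple) ∨ Neutral IsSimple M ∨
      ∃ M', SimpleHead M M' ∧ M'.IsSimple := by
  rcases h.clauses with h | ⟨M', h, h'⟩ | ⟨y, Ms, h, h'⟩
  · exact .inl h
  · rcases h.cases_head with rfl | ⟨M₁, h, hr⟩
    · exact .inr (.inl ⟨M', rfl, h'⟩)
    · exact .inr (.inr (.inr ⟨M₁, h, .of_clauses (.inr (.inl ⟨M', hr, h'⟩))⟩))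
  · rcases h.cases_head with rfl | ⟨M₁, h, hr⟩
    · exact .inr (.inr (.inl (neutral_apps Ms (.var y) h')))
    · exact .inr (.inr (.inr ⟨M₁, h, .of_clauses (.inr (.inr ⟨y, Ms, hr, h'⟩))⟩))

/-- Projection of a reduction over a simple head step: either the head redex is contracted in the
reduction, or it survives and the other steps are not multiplied. -/
theorem SimpleHead.project {M M' : Lam} (h : SimpleHead M M') : ∀ {n : ℕ} {N : Lam}, BetaN n M N →
    (∃ m < n, BetaN m M' N) ∨ ∃ m ≤ n, ∃ N', Lam.headStep N = some N' ∧ BetaN m M' N' := by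
  induction h with
  | beta A B hs =>
    intro n N h
    rcases h.of_app with ⟨a, b, P', B', rfl, hP, hB, hn⟩ | ⟨a, b, r, L, B', hP, hB, hr, hn⟩
    · obtain ⟨A', rfl, hA⟩ := hP.of_lam
      obtain ⟨m, hm, h⟩ := hA.inst_of_isSimpleRedex hs hB
      exact .inr ⟨m, by omega, _, rfl, h⟩
    · obtain ⟨A', e, hA⟩ := hP.of_lam
      cases e
      obtain ⟨m, hm, h⟩ := hA.inst_of_isSimpleRedex hs hB
      -- The contraction of the head redex itself is saved, whence the strict inequality.
      exact .inl ⟨m + r, by omega, h.trans hr⟩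
  | appL C _ ih =>
    intro n N h
    rcases h.of_app with ⟨a, b, P', C', rfl, hP, hC, hn⟩ | ⟨a, b, r, L, C', hP, hC, hr, hn⟩
    · rcases ih hP with ⟨m, hm, h⟩ | ⟨m, hm, P'', hs, h⟩
      · exact .inl ⟨m + b, by omega, h.app hC⟩
      · exact .inr ⟨m + b, by omega, _, headStep_app C' hs, h.app hC⟩
    -- Here the function part reaches an abstraction, which has no head step; so its own head redex
    -- was contracted on the way, and only the strict alternative remains.
    · rcases ih hP with ⟨m, hm, h⟩ | ⟨m, hm, P'', hs, h⟩
      · exact .inl ⟨m + b + (r + 1), by omega, (h.app hC).trans (.head (.beta L C') hr)⟩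
      · cases hs

/-- The clocked Lévy trees of a simple term and of one of its reducts, along with the length of
the reduction. -/
def SimpleMatch (n : ℕ) (S T : CInf) : Prop :=
  ∃ m ≤ n, ∃ M N : Lam, S = M.levyTree ∧ T = N.levyTree ∧ BetaN m M N ∧
    (M.IsSimple ∨ Neutral IsSimple M)

/-- The neutral alternative handles the binary application nodes of `y M₁ … Mₘ`, whose left children
are shorter spines; each node splits the budget between spine and last argument. -/
theorem SimpleMatch.layer {n : ℕ} {S T : CInf} (h : SimpleMatch n S T) :
    CInf.MatchLayer SimpleMatch n S T := by
  obtain ⟨m, hm, M, N, rfl, rfl, h, hM⟩ := h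
  have neutral : Neutral IsSimple M → CInf.MatchLayer SimpleMatch n M.levyTree N.levyTree := by
    intro hM
    have hN := hM.betaN h
    cases hM with
    | var k =>
      cases h with
      | refl => exact .refl _ _
      | head h _ => cases h
    | @app P Q hP hQ =>
      rcases h.of_app with ⟨a, b, P', Q', rfl, hP', hQ', hab⟩ | ⟨a, b, r, L, Q', hL, -⟩
      · rw [levyTree_app (Neutral.app hP hQ).headStep, levyTree_app hN.headStep]
        exact .app (a := a) (b := b) (by omega) ⟨a, le_rfl, P, P', rfl, rfl, hP', .inr hP⟩
          ⟨b, le_rfl, Q, Q', rfl, rfl, hQ', .inl hQ⟩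
      · cases hP.betaN hL
  rcases hM with hM | hM
  · rcases hM.cases_head with hM | ⟨M', rfl, hM'⟩ | hM | ⟨M', hs, hM'⟩
    · rw [levyTree_eq_of_not_hasWHNF hM fun ⟨W, hW, hW'⟩ => hM ⟨W, h.red.trans hW, hW'⟩]
      exact .refl _ _
    · obtain ⟨N', rfl, hN⟩ := h.of_lam
      rw [levyTree_lam, levyTree_lam]
      exact .lam ⟨m, hm, M', N', rfl, rfl, hN, .inl hM'⟩
    · exact neutral hM
    · rw [levyTree_of_headStep hs.headStep]
      rcases hs.project h with ⟨k, hk, h⟩ | ⟨k, hk, N', hN, h⟩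
      · exact .drop (m := k) (by omega) ⟨k, le_rfl, M', N, rfl, rfl, h, .inl hM'⟩
      · rw [levyTree_of_headStep hN]
        exact .tau ⟨k, by omega, M', N', rfl, rfl, h, .inl hM'⟩
  · exact neutral hM

end Lam

/-- If `N` is a reduct of a simple term `M`, then the clocked Lévy trees of `M` and `N` (exist, are
unique, and) are equal up to inserting and removing finitely many `τ`'s. -/
theorem mainTheorem4 (M N : Lam) (hM : M.IsSimple) (hMN : Lam.BetaRed M N) :
    (∃! S : CInf, M.IsClockedLevyTree S) ∧ (∃! T : CInf, N.IsClockedLevyTree T) ∧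
      N.EventuallyMatches M := by
  obtain ⟨n, h⟩ := Lam.exists_betaN hMN
  refine ⟨M.existsUnique_isClockedLevyTree, N.existsUnique_isClockedLevyTree, N.levyTree,
    M.levyTree, N.isClockedLevyTree_levyTree, M.isClockedLevyTree_levyTree, .symm _ _ ?_⟩
  exact CInf.tauEq_of_match Lam.SimpleMatch (fun _ _ _ h => h.layer) n _ _
    ⟨n, le_rfl, M, N, rfl, rfl, h, .inl hM⟩
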